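/- Let $q$ be a complex number with $0<|q|<1$. Put $(q)_m=\prod_{k=1}^{m}(1-q^k)$ for $m\in\mathbb{N}\cup\{\infty\}$, and use the convention $1/(q)_m=0$ for integers $m<0$. For every integer $n>2$ and all integers $c_1,\dots,c_{n-1}$, $$ \sum_{a \geq 0} (-1)^{na}\, \frac{q^{\frac{na(a+1)}{2} -a + a \sum_{k=1}^{n-1} c_{k}}}{(q)_{a}\prod_{k=1}^{n-1}(q)_{a+c_{k}}} = \frac{1}{(q)_{\infty}} \sum_{i_{1}, \dots, i_{n-2} \geq 0} (-1)^{\sum_{k=1}^{n-2}\sum_{j=1}^{k}i_{j}}\, \frac{q^{\frac{1}{2}\sum_{k=1}^{n-2}\bigl(\sum_{j=1}^{k}i_{j}\bigr)\bigl(1+\sum_{j=1}^{k}i_{j} \bigr)+ \sum_{k=2}^{n-1}\sum_{j=1}^{k-1}c_{k}i_{j}}}{\prod_{k=1}^{n-2}(q)_{i_{k}}\,\prod_{k=1}^{n-2} (q)_{c_{k} +\sum_{j=1}^{k}i_{j} }}, $$ where both series converge absolutely. -/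

import Mathlib

noncomputable section

/-- The finite `q`-Pochhammer symbol `(a; q)_n = ∏_{k=1}^{n} (1 - a q^{k-1})`. -/
def qPoch (a q : ℂ) (n : ℕ) : ℂ :=
  ∏ k ∈ Finset.range n, (1 - a * q ^ k)

/-- The infinite `q`-Pochhammer symbol `(a; q)_∞ = ∏_{k ≥ 1} (1 - a q^{k-1})`. -/
def qPochInf (a q : ℂ) : ℂ :=
  ∏' k : ℕ, (1 - a * q ^ k)

/-- The reciprocal `1 / (q)_m` with `(q)_m = (q; q)_m`, for an integer `m`, with the convention
that it is `0` for `m < 0`. -/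
def qRecip (q : ℂ) (m : ℤ) : ℂ :=
  if m < 0 then 0 else 1 / qPoch q q m.toNat

/-- The partial sum `i_1 + ⋯ + i_k` of a tuple `(i_1, …, i_m)`; the entry `i_j` is
stored at the position `j - 1` of `Fin m`. -/
def partSum {m : ℕ} (i : Fin m → ℕ) (k : ℕ) : ℕ :=
  ∑ j ∈ Finset.univ.filter (fun j : Fin m => (j : ℕ) < k), i j

/-- The term of index `a` of the single sum. Here `c k` stands for `c_k`, `1 ≤ k ≤ n - 1`.
The division by `2` in the exponent is exact. -/
def singleTerm (q : ℂ) (n : ℕ) (c : ℕ → ℤ) (a : ℕ) : ℂ :=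
  (-1) ^ (n * a) *
    q ^ ((n * a * (a + 1) : ℤ) / 2 - a + a * ∑ k ∈ Finset.Icc 1 (n - 1), c k) *
    (qRecip q a * ∏ k ∈ Finset.Icc 1 (n - 1), qRecip q (a + c k))

/-- The term of index `(i_1, …, i_{n-2})` of the multiple sum.
The division by `2` in the exponent is exact. -/
def multiTerm (q : ℂ) (n : ℕ) (c : ℕ → ℤ) (i : Fin (n - 2) → ℕ) : ℂ :=
  (-1) ^ (∑ k ∈ Finset.Icc 1 (n - 2), partSum i k) *
    q ^ ((∑ k ∈ Finset.Icc 1 (n - 2), (partSum i k : ℤ) * (1 + partSum i k)) / 2 +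
      ∑ k ∈ Finset.Icc 2 (n - 1), c k * (partSum i (k - 1) : ℤ)) *
    ((∏ k : Fin (n - 2), qRecip q (i k)) *
      ∏ k ∈ Finset.Icc 1 (n - 2), qRecip q (c k + partSum i k))

end

/-!
For a sequence `g`, put `L g = ∑ (-1) ^ a q ^ (a (a - 1) / 2) g a / (q)_a`, so that the single sum
is `L` of a product of `n - 1` factors `T_c a = (-1) ^ a q ^ (a (a + 1) / 2 + a c) / (q)_{a + c}`,
one for each `c = c_k`. Inverting the finite Durfee rectangle identity gives
`L (T_c g) = ∑ L (g (x + ·)) / ((q)_x (q)_{x + c})`, summed over `x ≥ 0`, and the shift by `x` only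
changes the remaining factors by `T_c (x + a) = (-1) ^ x q ^ (x (x + 1) / 2 + x c) T_{c + x} a`.
Applying this `n - 2` times removes `c_1, …, c_{n-2}` and creates one summation index `i_k` at a
time. The limiting form `L T_c = 1 / (q)_∞` of the Durfee rectangle identity disposes of the last
factor.
-/

open Filter Topology Finset

section SeriesRearrangement

lemma tsum_sum_antidiagonal {A α : Type*} [AddCommMonoid A] [HasAntidiagonal A] [AddCommMonoid α]
    [TopologicalSpace α] [ContinuousAdd α] [T3Space α] {f : A × A → α} (hf : Summable f) :
    ∑' n, ∑ p ∈ antidiagonal n, f p = ∑' p, f p := by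
  rw [← HasAntidiagonal.sigmaAntidiagonalEquivProd.tsum_eq f]
  refine Eq.trans (tsum_congr fun n => (Finset.tsum_subtype (antidiagonal n) f).symm) ?_
  exact ((HasAntidiagonal.sigmaAntidiagonalEquivProd.summable_iff.mpr hf).tsum_sigma'
    fun n => (hasSum_fintype _).summable).symm

lemma tsum_fin_succ_pi {α β : Type*} [AddCommGroup α] [UniformSpace α] [IsUniformAddGroup α]
    [CompleteSpace α] [T0Space α] {m : ℕ} {f : (Fin (m + 1) → β) → α} (hf : Summable f) :
    ∑' i, f i = ∑' (x : β) (t : Fin m → β), f (Fin.cons x t) := by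
  rw [← (Fin.consEquiv fun _ => β).tsum_eq]
  exact ((Fin.consEquiv fun _ => β).summable_iff.mpr hf).tsum_prod

lemma summable_prod_apply {β R : Type*} [NormedCommRing R] [CompleteSpace R] {f : β → R}
    (hf : Summable fun x => ‖f x‖) (m : ℕ) : Summable fun i : Fin m → β => ‖∏ k, f (i k)‖ := by
  induction m with
  | zero => exact Summable.of_finite
  | succ m ih =>
    rw [← (Fin.consEquiv fun _ => β).summable_iff]
    simpa [Function.comp_def, Fin.consEquiv, Fin.prod_univ_succ] using! hf.mul_norm ih

lemma tendsto_sum_antidiagonal_mul {R : Type*} [NormedRing R] [CompleteSpace R] {f g : ℕ → R}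
    {l : R} (hf : Summable fun n => ‖f n‖) (hg : Tendsto g atTop (𝓝 l)) :
    Tendsto (fun n => ∑ p ∈ antidiagonal n, f p.1 * g p.2) atTop (𝓝 ((∑' n, f n) * l)) := by
  obtain ⟨C, hC⟩ := hg.norm.bddAbove_range
  have hgC : ∀ n, ‖g n‖ ≤ C := fun n => hC ⟨n, rfl⟩
  have hsum : ∀ n, ∑ p ∈ antidiagonal n, f p.1 * g p.2 =
      ∑' a, if a ≤ n then f a * g (n - a) else 0 := fun n => by
    rw [Nat.sum_antidiagonal_eq_sum_range_succ (fun a b => f a * g b),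
      tsum_eq_sum (s := range n.succ) fun a ha => if_neg (by simpa using ha)]
    exact sum_congr rfl fun a ha => (if_pos (by simpa [Nat.lt_succ_iff] using ha)).symm
  simp only [hsum, ← hf.of_norm.tsum_mul_right]
  refine tendsto_tsum_of_dominated_convergence (hf.mul_right C) (fun a => ?_)
    (Eventually.of_forall fun n a => ?_)
  · refine ((hg.comp (tendsto_sub_atTop_nat a)).const_mul (f a)).congr' ?_
    filter_upwards [eventually_ge_atTop a] with n hn using (if_pos hn).symm
  · split_ifs
    · exact (norm_mul_le _ _).trans (mul_le_mul_of_nonneg_left (hgC _) (norm_nonneg _))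
    · simpa using mul_nonneg (norm_nonneg (f a)) ((norm_nonneg _).trans (hgC 0))

end SeriesRearrangement

section QPochhammer

variable {q : ℂ}

lemma qPoch_succ (a q : ℂ) (n : ℕ) : qPoch a q (n + 1) = qPoch a q n * (1 - a * q ^ n) :=
  prod_range_succ _ n

lemma one_sub_mul_pow_ne_zero (hq1 : ‖q‖ < 1) (k : ℕ) : 1 - q * q ^ k ≠ 0 := by
  intro h
  have hnorm : ‖q‖ ^ (k + 1) = 1 := by
    rw [← norm_pow, pow_succ', ← sub_eq_zero.mp h, norm_one]
  exact (pow_lt_one₀ (norm_nonneg q) hq1 k.succ_ne_zero).ne hnorm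

lemma qPoch_self_ne_zero (hq1 : ‖q‖ < 1) (n : ℕ) : qPoch q q n ≠ 0 :=
  prod_ne_zero_iff.mpr fun k _ => one_sub_mul_pow_ne_zero hq1 k

lemma one_sub_pow_succ_ne_zero (hq : ∀ n, qPoch q q n ≠ 0) (n : ℕ) : 1 - q ^ (n + 1) ≠ 0 :=
  pow_succ' q n ▸ right_ne_zero_of_mul (qPoch_succ q q n ▸ hq (n + 1))

lemma summable_norm_neg_mul_pow (a : ℂ) (hq1 : ‖q‖ < 1) :
    Summable fun k : ℕ => ‖-(a * q ^ k)‖ := by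
  simpa using (summable_geometric_of_lt_one (norm_nonneg q) hq1).mul_left ‖a‖

lemma qPochInf_self_ne_zero (hq1 : ‖q‖ < 1) : qPochInf q q ≠ 0 := by
  simpa [qPochInf, sub_eq_add_neg] using
    tprod_one_add_ne_zero_of_summable (f := fun k : ℕ => -(q * q ^ k))
      (fun k => by simpa [sub_eq_add_neg] using one_sub_mul_pow_ne_zero hq1 k)
      (summable_norm_neg_mul_pow q hq1)

lemma tendsto_qPoch (a : ℂ) (hq1 : ‖q‖ < 1) :
    Tendsto (qPoch a q) atTop (𝓝 (qPochInf a q)) := by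
  have h := (multipliable_one_add_of_summable
    (summable_norm_neg_mul_pow a hq1)).tendsto_prod_tprod_nat
  simpa [qPochInf, qPoch, sub_eq_add_neg, funext_iff] using! h

lemma qRecip_of_neg (q : ℂ) {m : ℤ} (hm : m < 0) : qRecip q m = 0 := if_pos hm

lemma qRecip_of_nonneg (q : ℂ) {m : ℤ} (hm : 0 ≤ m) : qRecip q m = 1 / qPoch q q m.toNat :=
  if_neg hm.not_gt

@[simp] lemma qRecip_zero (q : ℂ) : qRecip q 0 = 1 := by
  simp [qRecip, qPoch]

lemma qRecip_sub_one (hq : ∀ n, qPoch q q n ≠ 0) (m : ℤ) :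
    qRecip q (m - 1) = (1 - q ^ m) * qRecip q m := by
  rcases lt_trichotomy m 0 with hm | rfl | hm
  · rw [qRecip_of_neg q hm, qRecip_of_neg q (by omega), mul_zero]
  · rw [qRecip_of_neg q (by omega), zpow_zero, sub_self, zero_mul]
  · obtain ⟨k, rfl⟩ : ∃ k : ℕ, m = k + 1 := ⟨(m - 1).toNat, by omega⟩
    have hfactor := one_sub_pow_succ_ne_zero hq k
    rw [add_sub_cancel_right, qRecip_of_nonneg q (by omega), qRecip_of_nonneg q (by omega),
      Int.toNat_natCast, Int.toNat_natCast_add_one, qPoch_succ, ← pow_succ']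
    norm_cast
    field_simp

lemma qRecip_eq_one_sub_mul (hq : ∀ n, qPoch q q n ≠ 0) (m : ℤ) :
    qRecip q m = (1 - q ^ (m + 1)) * qRecip q (m + 1) := by
  rw [← qRecip_sub_one hq, add_sub_cancel_right]

lemma tendsto_qRecip (hq1 : ‖q‖ < 1) : Tendsto (qRecip q) atTop (𝓝 (1 / qPochInf q q)) := by
  have htoNat : Tendsto Int.toNat atTop atTop :=
    tendsto_atTop_atTop.mpr fun n => ⟨n, fun m hm => by omega⟩
  simp only [one_div]
  refine (((tendsto_qPoch q hq1).inv₀ (qPochInf_self_ne_zero hq1)).comp htoNat).congr' ?_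
  filter_upwards [eventually_ge_atTop 0] with m hm
  rw [qRecip_of_nonneg q hm, one_div, Function.comp_apply]

lemma exists_norm_qRecip_le (hq1 : ‖q‖ < 1) : ∃ C : ℝ, ∀ m, ‖qRecip q m‖ ≤ C := by
  obtain ⟨C, hC⟩ := ((tendsto_qRecip hq1).comp tendsto_natCast_atTop_atTop).norm.bddAbove_range
  have hnat : ∀ m : ℕ, ‖qRecip q m‖ ≤ C := fun m => hC ⟨m, rfl⟩
  refine ⟨C, fun m => ?_⟩
  rcases lt_or_ge m 0 with hm | hm
  · simpa [qRecip_of_neg q hm] using (norm_nonneg _).trans (hnat 0)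
  · lift m to ℕ using hm
    exact hnat m

/-- The `q`-Pascal rule `[n+1, i] = [n, i-1] + q ^ i [n, i]`, summed against arbitrary weights. -/
lemma one_sub_pow_mul_sum_antidiagonal_succ (hq : ∀ n, qPoch q q n ≠ 0) (f : ℕ → ℕ → ℂ) (n : ℕ) :
    (1 - q ^ (n + 1)) *
        ∑ p ∈ antidiagonal (n + 1), f p.1 p.2 * (qRecip q p.1 * qRecip q p.2) =
      ∑ p ∈ antidiagonal n,
        (f (p.1 + 1) p.2 + q ^ p.1 * f p.1 (p.2 + 1)) * (qRecip q p.1 * qRecip q p.2) := by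
  have hsplit : ∀ p ∈ antidiagonal (n + 1),
      (1 - q ^ (n + 1)) * (f p.1 p.2 * (qRecip q p.1 * qRecip q p.2)) =
        f p.1 p.2 * (qRecip q (p.1 - 1) * qRecip q p.2) +
          q ^ p.1 * f p.1 p.2 * (qRecip q p.1 * qRecip q (p.2 - 1)) := fun p hp => by
    rw [qRecip_sub_one hq, qRecip_sub_one hq, ← mem_antidiagonal.mp hp, pow_add, zpow_natCast,
      zpow_natCast]
    ring
  have hboundary : qRecip q ((0 : ℕ) - 1) = 0 := qRecip_of_neg q (by norm_num)
  rw [mul_sum, sum_congr rfl hsplit, sum_add_distrib, Nat.sum_antidiagonal_succ,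
    Nat.sum_antidiagonal_succ']
  simp only [hboundary, Nat.cast_succ, add_sub_cancel_right, zero_mul, mul_zero, zero_add,
    add_mul, sum_add_distrib]

end QPochhammer

section PartialTheta

variable {q : ℂ}

/-- The term `(-1) ^ s q ^ (s (s + 1) / 2 + s c)` of a partial theta series, with the triangular
number written as a binomial coefficient. Both sides of the theorem are products of such terms and
of reciprocals `1 / (q)_m`. -/
noncomputable def thetaTerm (q : ℂ) (c : ℤ) (s : ℕ) : ℂ :=
  (-1) ^ s * q ^ (((s + 1).choose 2 : ℤ) + s * c)

lemma two_mul_choose_succ_two (s : ℕ) : 2 * ((s + 1).choose 2 : ℤ) = s * (s + 1) := by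
  have h := Nat.add_one_mul_choose_eq s 1
  rw [Nat.choose_one_right] at h
  push_cast [← @Nat.cast_inj ℤ] at h
  linarith

@[simp] lemma thetaTerm_zero (q : ℂ) (c : ℤ) : thetaTerm q c 0 = 1 := by
  simp [thetaTerm]

lemma thetaTerm_add (hq0 : q ≠ 0) (c : ℤ) (s t : ℕ) :
    thetaTerm q c (s + t) = thetaTerm q c s * thetaTerm q (c + s) t := by
  have hexp : ((s + t + 1).choose 2 : ℤ) + (s + t : ℕ) * c =
      ((s + 1).choose 2 + s * c) + ((t + 1).choose 2 + t * (c + s)) := by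
    have hst := two_mul_choose_succ_two (s + t)
    push_cast at hst ⊢
    linarith [two_mul_choose_succ_two s, two_mul_choose_succ_two t]
  rw [thetaTerm, hexp, zpow_add₀ hq0, pow_add, thetaTerm, thetaTerm]
  ring

lemma thetaTerm_neg_one_succ (hq0 : q ≠ 0) (s : ℕ) :
    thetaTerm q (-1) (s + 1) = -(q ^ s * thetaTerm q (-1) s) := by
  rw [thetaTerm_add hq0, thetaTerm.eq_1 q _ 1]
  simp [mul_comm]

lemma thetaTerm_neg_one_mul_thetaTerm (hq0 : q ≠ 0) (c : ℤ) (s : ℕ) :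
    thetaTerm q (-1) s * thetaTerm q c s = q ^ ((s : ℤ) * (s + c)) := by
  have hexp : (s : ℤ) * (s + c) = ((s + 1).choose 2 + s * (-1)) + ((s + 1).choose 2 + s * c) := by
    linarith [two_mul_choose_succ_two s]
  rw [hexp, zpow_add₀ hq0, thetaTerm, thetaTerm, mul_mul_mul_comm, ← mul_pow, neg_one_mul, neg_neg,
    one_pow, one_mul]

lemma norm_thetaTerm_le (hq0 : q ≠ 0) (hq1 : ‖q‖ < 1) (c : ℤ) (s : ℕ) :
    ‖thetaTerm q c s‖ ≤ ‖q‖ ^ (-c ^ 2) * ‖q‖ ^ s := by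
  have hpos : 0 < ‖q‖ := norm_pos_iff.mpr hq0
  have hexp : -c ^ 2 + (s : ℤ) ≤ (s + 1).choose 2 + s * c := by
    linarith [two_mul_choose_succ_two s, Int.le_self_sq (s + c), Int.le_self_sq (-c)]
  rw [thetaTerm, norm_mul, norm_pow, norm_neg, norm_one, one_pow, one_mul, norm_zpow,
    ← zpow_natCast ‖q‖ s, ← zpow_add₀ hpos.ne']
  exact zpow_le_zpow_right_of_le_one₀ hpos hq1.le hexp

end PartialTheta

section Vandermonde

variable {q : ℂ}

/-- Expansion by the Durfee rectangle of sides `i` and `i + c`. -/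
lemma sum_antidiagonal_zpow_mul_qRecip (hq : ∀ n, qPoch q q n ≠ 0) (hq0 : q ≠ 0) (n : ℕ) (c : ℤ) :
    ∑ p ∈ antidiagonal n,
        q ^ ((p.1 : ℤ) * (p.1 + c)) * qRecip q (p.1 + c) * (qRecip q p.1 * qRecip q p.2) =
      qRecip q n * qRecip q (n + c) := by
  induction n generalizing c with
  | zero => simp
  | succ n ih =>
    have hweight : ∀ i : ℕ, q ^ (((i + 1 : ℕ) : ℤ) * ((i + 1 : ℕ) + c)) *
          qRecip q ((i + 1 : ℕ) + c) + q ^ i * (q ^ ((i : ℤ) * (i + c)) * qRecip q (i + c)) =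
        q ^ ((i : ℤ) * (i + (c + 1))) * qRecip q (i + (c + 1)) := fun i => by
      rw [qRecip_eq_one_sub_mul hq (i + c), Nat.cast_succ,
        show ((i : ℤ) + 1) * (i + 1 + c) = i + i * (i + c) + (i + c + 1) by ring,
        show (i : ℤ) * (i + (c + 1)) = i + i * (i + c) by ring, add_right_comm (i : ℤ) 1 c,
        ← add_assoc (i : ℤ) c 1, zpow_add₀ hq0 (i + i * (i + c)), zpow_add₀ hq0 (i : ℤ),
        zpow_natCast]
      ring
    apply mul_left_cancel₀ (one_sub_pow_succ_ne_zero hq n)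
    rw [one_sub_pow_mul_sum_antidiagonal_succ hq
      fun i _ => q ^ ((i : ℤ) * (i + c)) * qRecip q (i + c)]
    simp only [hweight, ih]
    rw [qRecip_eq_one_sub_mul hq n, Nat.cast_succ, add_right_comm, add_assoc]
    norm_cast
    ring

/-- The inverse of the Durfee rectangle expansion, since the power series with coefficients
`thetaTerm q (-1) j / (q)_j` is the reciprocal of the one with coefficients `1 / (q)_j`. -/
lemma sum_antidiagonal_thetaTerm_mul_qRecip (hq : ∀ n, qPoch q q n ≠ 0) (hq0 : q ≠ 0) (n : ℕ)
    (c : ℤ) :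
    ∑ p ∈ antidiagonal n,
        thetaTerm q (-1) p.2 * qRecip q (p.1 + c) * (qRecip q p.1 * qRecip q p.2) =
      q ^ ((n : ℤ) * (n + c)) * (qRecip q n * qRecip q (n + c)) := by
  induction n generalizing c with
  | zero => simp
  | succ n ih =>
    have hweight : ∀ p ∈ antidiagonal n,
        (thetaTerm q (-1) p.2 * qRecip q ((p.1 + 1 : ℕ) + c) +
            q ^ p.1 * (thetaTerm q (-1) (p.2 + 1) * qRecip q (p.1 + c))) *
            (qRecip q p.1 * qRecip q p.2) =
          thetaTerm q (-1) p.2 * qRecip q (p.1 + (c + 1)) * (qRecip q p.1 * qRecip q p.2) -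
            q ^ n * (thetaTerm q (-1) p.2 * qRecip q (p.1 + c) *
              (qRecip q p.1 * qRecip q p.2)) := fun p hp => by
      rw [thetaTerm_neg_one_succ hq0, Nat.cast_succ, add_assoc, add_comm 1 c,
        ← mem_antidiagonal.mp hp, pow_add]
      ring
    apply mul_left_cancel₀ (one_sub_pow_succ_ne_zero hq n)
    rw [one_sub_pow_mul_sum_antidiagonal_succ hq
      fun i j => thetaTerm q (-1) j * qRecip q (i + c), sum_congr rfl hweight, sum_sub_distrib,
      ← mul_sum, ih, ih, qRecip_eq_one_sub_mul hq n, qRecip_eq_one_sub_mul hq (n + c),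
      Nat.cast_succ, show ((n : ℤ) + 1) * (n + 1 + c) = n + n * (n + c) + (n + c + 1) by ring,
      show (n : ℤ) * (n + (c + 1)) = n + n * (n + c) by ring, add_right_comm (n : ℤ) 1 c,
      ← add_assoc (n : ℤ) c 1, zpow_add₀ hq0 (n + n * (n + c)), zpow_add₀ hq0 (n : ℤ)]
    norm_cast
    ring

end Vandermonde

section SingleSeries

variable {q : ℂ}

/-- The coefficient `(-1) ^ a q ^ (a (a - 1) / 2) / (q)_a` of `t ^ a` in Euler's expansion of
`(t; q)_∞`. -/
noncomputable def eulerCoeff (q : ℂ) (a : ℕ) : ℂ :=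
  thetaTerm q (-1) a * qRecip q a

/-- The factor `(-1) ^ a q ^ (a (a + 1) / 2 + a c) / (q)_{a + c}` that each `c = c_k` contributes
to the single sum. -/
noncomputable def thetaQuot (q : ℂ) (c : ℤ) (a : ℕ) : ℂ :=
  thetaTerm q c a * qRecip q (a + c)

lemma thetaQuot_add (hq0 : q ≠ 0) (c : ℤ) (x a : ℕ) :
    thetaQuot q c (x + a) = thetaTerm q c x * thetaQuot q (c + x) a := by
  rw [thetaQuot, thetaQuot, thetaTerm_add hq0, mul_assoc, Nat.cast_add, add_comm (x : ℤ), add_assoc,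
    add_comm (x : ℤ)]

lemma exists_norm_eulerCoeff_le (hq0 : q ≠ 0) (hq1 : ‖q‖ < 1) :
    ∃ K : ℝ, ∀ a, ‖eulerCoeff q a‖ ≤ K := by
  obtain ⟨C, hC⟩ := exists_norm_qRecip_le hq1
  refine ⟨‖q‖ ^ (-(-1) ^ 2 : ℤ) * C, fun a => ?_⟩
  rw [eulerCoeff, norm_mul]
  have htheta : ‖thetaTerm q (-1) a‖ ≤ ‖q‖ ^ (-(-1) ^ 2 : ℤ) :=
    (norm_thetaTerm_le hq0 hq1 (-1) a).trans
      (mul_le_of_le_one_right (by positivity) (pow_le_one₀ (norm_nonneg q) hq1.le))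
  exact mul_le_mul htheta (hC a) (norm_nonneg _) (by positivity)

lemma exists_norm_thetaQuot_le (hq0 : q ≠ 0) (hq1 : ‖q‖ < 1) :
    ∃ K : ℤ → ℝ, ∀ c s, ‖thetaQuot q c s‖ ≤ K c * ‖q‖ ^ s := by
  obtain ⟨C, hC⟩ := exists_norm_qRecip_le hq1
  refine ⟨fun c => ‖q‖ ^ (-c ^ 2) * C, fun c s => ?_⟩
  rw [thetaQuot, norm_mul, mul_right_comm]
  exact mul_le_mul (norm_thetaTerm_le hq0 hq1 c s) (hC _) (norm_nonneg _) (by positivity)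

lemma exists_norm_prod_thetaQuot_le (hq0 : q ≠ 0) (hq1 : ‖q‖ < 1) {ι : Type*} {t : Finset ι}
    (ht : t.Nonempty) (c : ι → ℤ) :
    ∃ K : ℝ, ∀ s, ‖∏ k ∈ t, thetaQuot q (c k) s‖ ≤ K * ‖q‖ ^ s := by
  obtain ⟨K, hK⟩ := exists_norm_thetaQuot_le hq0 hq1
  have hK0 : ∀ d, 0 ≤ K d := fun d => by simpa using (norm_nonneg _).trans (hK d 0)
  refine ⟨∏ k ∈ t, K (c k), fun s => ?_⟩
  calc ‖∏ k ∈ t, thetaQuot q (c k) s‖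
      ≤ ∏ k ∈ t, K (c k) * ‖q‖ ^ s := by
        rw [norm_prod]
        exact prod_le_prod (fun _ _ => norm_nonneg _) fun k _ => hK (c k) s
    _ = (∏ k ∈ t, K (c k)) * (‖q‖ ^ s) ^ #t := by rw [prod_mul_distrib, prod_const]
    _ ≤ (∏ k ∈ t, K (c k)) * ‖q‖ ^ s :=
        mul_le_mul_of_nonneg_left
          (pow_le_of_le_one (by positivity) (pow_le_one₀ (norm_nonneg q) hq1.le) ht.card_ne_zero)
          (prod_nonneg fun k _ => hK0 (c k))

lemma summable_prod_thetaQuot_add (hq0 : q ≠ 0) (hq1 : ‖q‖ < 1) {ι : Type*} {t : Finset ι}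
    (ht : t.Nonempty) (c : ι → ℤ) (x : ℕ) :
    Summable fun p : ℕ × ℕ => ∏ k ∈ t, thetaQuot q (c k) (x + (p.1 + p.2)) := by
  obtain ⟨K, hK⟩ := exists_norm_prod_thetaQuot_le hq0 hq1 ht c
  have hgeom := summable_geometric_of_lt_one (norm_nonneg q) hq1
  refine .of_norm_bounded
    ((hgeom.mul_of_nonneg hgeom (fun _ => by positivity) fun _ => by positivity).mul_left
      (K * ‖q‖ ^ x)) fun p => (hK _).trans_eq ?_
  ring

lemma summable_eulerCoeff_mul (hq0 : q ≠ 0) (hq1 : ‖q‖ < 1) {g : ℕ → ℂ} (hg : Summable g) :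
    Summable fun a => eulerCoeff q a * g a := by
  obtain ⟨K, hK⟩ := exists_norm_eulerCoeff_le hq0 hq1
  refine .of_norm_bounded (hg.norm.mul_left K) fun a => ?_
  rw [norm_mul]
  exact mul_le_mul_of_nonneg_right (hK a) (norm_nonneg _)

lemma summable_eulerCoeff_mul_prod_thetaQuot (hq0 : q ≠ 0) (hq1 : ‖q‖ < 1) {ι : Type*}
    {t : Finset ι} (ht : t.Nonempty) (c : ι → ℤ) :
    Summable fun a => eulerCoeff q a * ∏ k ∈ t, thetaQuot q (c k) a := by
  obtain ⟨K, hK⟩ := exists_norm_prod_thetaQuot_le hq0 hq1 ht c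
  exact summable_eulerCoeff_mul hq0 hq1 <| .of_norm_bounded
    ((summable_geometric_of_lt_one (norm_nonneg q) hq1).mul_left K) hK

lemma eulerCoeff_mul_thetaQuot (hq0 : q ≠ 0) (c : ℤ) (a : ℕ) :
    eulerCoeff q a * thetaQuot q c a =
      q ^ ((a : ℤ) * (a + c)) * (qRecip q a * qRecip q (a + c)) := by
  rw [eulerCoeff, thetaQuot, mul_mul_mul_comm, thetaTerm_neg_one_mul_thetaTerm hq0]

/-- Cauchy's identity, the limit `n → ∞` of the Durfee rectangle expansion. -/
lemma tsum_eulerCoeff_mul_thetaQuot (hq0 : q ≠ 0) (hq1 : ‖q‖ < 1) (c : ℤ) :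
    ∑' a, eulerCoeff q a * thetaQuot q c a = 1 / qPochInf q q := by
  have hrecip := (tendsto_qRecip hq1).comp tendsto_natCast_atTop_atTop
  have hshift : Tendsto (fun n : ℕ => qRecip q (n + c)) atTop (𝓝 (1 / qPochInf q q)) :=
    (tendsto_qRecip hq1).comp (tendsto_atTop_add_const_right _ c tendsto_natCast_atTop_atTop)
  have hsummable : Summable fun a => eulerCoeff q a * thetaQuot q c a := by
    simpa using summable_eulerCoeff_mul_prod_thetaQuot hq0 hq1 (singleton_nonempty c) id
  have hdurfee : ∀ n : ℕ, ∑ p ∈ antidiagonal n,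
      eulerCoeff q p.1 * thetaQuot q c p.1 * qRecip q p.2 = qRecip q n * qRecip q (n + c) :=
    fun n => by
      rw [← sum_antidiagonal_zpow_mul_qRecip (qPoch_self_ne_zero hq1) hq0]
      refine sum_congr rfl fun p _ => ?_
      rw [eulerCoeff_mul_thetaQuot hq0]
      ring
  have hlimit := tendsto_nhds_unique (tendsto_sum_antidiagonal_mul hsummable.norm hrecip)
    ((hrecip.mul hshift).congr fun n => (hdurfee n).symm)
  exact mul_right_cancel₀ (one_div_ne_zero (qPochInf_self_ne_zero hq1)) hlimit

lemma sum_antidiagonal_qRecip_mul_eulerCoeff (hq0 : q ≠ 0) (hq : ∀ n, qPoch q q n ≠ 0) (n : ℕ)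
    (c : ℤ) :
    ∑ p ∈ antidiagonal n, qRecip q p.1 * qRecip q (p.1 + c) * eulerCoeff q p.2 =
      eulerCoeff q n * thetaQuot q c n := by
  rw [eulerCoeff_mul_thetaQuot hq0, ← sum_antidiagonal_thetaTerm_mul_qRecip hq hq0]
  refine sum_congr rfl fun p _ => ?_
  rw [eulerCoeff]
  ring

lemma tsum_eulerCoeff_mul_thetaQuot_mul (hq0 : q ≠ 0) (hq1 : ‖q‖ < 1) (c : ℤ) {g : ℕ → ℂ}
    (hg : Summable fun p : ℕ × ℕ => g (p.1 + p.2)) :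
    ∑' b, eulerCoeff q b * (thetaQuot q c b * g b) =
      ∑' x : ℕ, qRecip q x * qRecip q (x + c) * ∑' a, eulerCoeff q a * g (x + a) := by
  obtain ⟨C, hC⟩ := exists_norm_qRecip_le hq1
  obtain ⟨K, hK⟩ := exists_norm_eulerCoeff_le hq0 hq1
  have hC0 : 0 ≤ C := (norm_nonneg _).trans (hC 0)
  have hsummable : Summable fun p : ℕ × ℕ =>
      qRecip q p.1 * qRecip q (p.1 + c) * (eulerCoeff q p.2 * g (p.1 + p.2)) := by
    refine .of_norm_bounded (hg.norm.mul_left (C * C * K)) fun p => ?_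
    simp only [norm_mul, mul_assoc]
    gcongr
    exacts [hC _, hC _, hK _]
  have hdiagonal : ∀ b : ℕ, ∑ p ∈ antidiagonal b,
      qRecip q p.1 * qRecip q (p.1 + c) * (eulerCoeff q p.2 * g (p.1 + p.2)) =
        eulerCoeff q b * (thetaQuot q c b * g b) := fun b => by
    rw [← mul_assoc, ← sum_antidiagonal_qRecip_mul_eulerCoeff hq0 (qPoch_self_ne_zero hq1), sum_mul]
    refine sum_congr rfl fun p hp => ?_
    rw [mem_antidiagonal.mp hp, mul_assoc _ (eulerCoeff q p.2)]
  rw [← tsum_congr hdiagonal, tsum_sum_antidiagonal hsummable, hsummable.tsum_prod]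
  simp only [tsum_mul_left]

end SingleSeries

section MultipleSeries

variable {q : ℂ}

/-- The factor of index `k` of the term `i` of the multiple sum, for the parameters `c 0, c 1, …`
and with all partial sums `i 0 + ⋯ + i k` increased by `x`. The shift `x` keeps track of the
indices already split off when the tuple `i` is built up one entry at a time. -/
noncomputable def chainFactor (q : ℂ) (c : ℕ → ℤ) (x : ℕ) {m : ℕ} (i : Fin m → ℕ) (k : Fin m) : ℂ :=
  thetaTerm q (c (k + 1)) (x + partSum i (k + 1)) *
    (qRecip q (i k) * qRecip q (c k + (x + partSum i (k + 1) : ℕ)))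

lemma partSum_cons_succ {m : ℕ} (y : ℕ) (t : Fin m → ℕ) (k : ℕ) :
    partSum (Fin.cons y t : Fin (m + 1) → ℕ) (k + 1) = y + partSum t k := by
  simp [partSum, sum_filter, Fin.sum_univ_succ]

lemma le_partSum_succ {m : ℕ} (i : Fin m → ℕ) (k : Fin m) : i k ≤ partSum i (k + 1) :=
  single_le_sum (f := i) (fun _ _ => Nat.zero_le _) (by simp)

lemma prod_chainFactor_cons (q : ℂ) (c : ℕ → ℤ) (x y : ℕ) {m : ℕ} (t : Fin m → ℕ) :
    ∏ k, chainFactor q c x (Fin.cons y t : Fin (m + 1) → ℕ) k =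
      thetaTerm q (c 1) (x + y) * (qRecip q y * qRecip q (c 0 + (x + y : ℕ))) *
        ∏ k, chainFactor q (fun j => c (j + 1)) (x + y) t k := by
  have hzero : partSum t 0 = 0 := by simp [partSum]
  rw [Fin.prod_univ_succ]
  simp only [chainFactor, Fin.val_zero, Fin.val_succ, partSum_cons_succ, Fin.cons_zero,
    Fin.cons_succ, hzero, add_zero, zero_add, ← add_assoc]

lemma summable_prod_chainFactor (hq0 : q ≠ 0) (hq1 : ‖q‖ < 1) (c : ℕ → ℤ) (x m : ℕ) :
    Summable fun i : Fin m → ℕ => ∏ k, chainFactor q c x i k := by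
  obtain ⟨C, hC⟩ := exists_norm_qRecip_le hq1
  have hC0 : 0 ≤ C := (norm_nonneg _).trans (hC 0)
  have hfactor : ∀ (i : Fin m → ℕ) k,
      ‖chainFactor q c x i k‖ ≤ ‖q‖ ^ (-c (k + 1) ^ 2) * (C * C) * ‖q ^ i k‖ := fun i k => by
    have htheta : ‖thetaTerm q (c (k + 1)) (x + partSum i (k + 1))‖ ≤
        ‖q‖ ^ (-c (k + 1) ^ 2) * ‖q‖ ^ i k :=
      (norm_thetaTerm_le hq0 hq1 _ _).trans <| mul_le_mul_of_nonneg_left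
        (pow_le_pow_of_le_one (norm_nonneg q) hq1.le (le_add_left (le_partSum_succ i k)))
        (by positivity)
    rw [chainFactor, norm_mul, norm_mul, norm_pow, mul_right_comm]
    gcongr
    exacts [hC _, hC _]
  have hgeom : Summable fun i : Fin m → ℕ => ‖∏ k, q ^ i k‖ :=
    summable_prod_apply (summable_norm_geometric_of_norm_lt_one hq1) m
  refine .of_norm_bounded
    (hgeom.mul_left (∏ k : Fin m, ‖q‖ ^ (-c (k + 1) ^ 2) * (C * C))) fun i => ?_
  rw [norm_prod, norm_prod, ← prod_mul_distrib]
  exact prod_le_prod (fun _ _ => norm_nonneg _) fun k _ => hfactor i k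

lemma tsum_eulerCoeff_mul_prod_thetaQuot_add_succ (hq0 : q ≠ 0) (hq1 : ‖q‖ < 1) (c : ℕ → ℤ)
    (x m : ℕ) :
    ∑' a, eulerCoeff q a * ∏ k ∈ range (m + 2), thetaQuot q (c k) (x + a) =
      thetaTerm q (c 0) x * ∑' y : ℕ, qRecip q y * qRecip q (c 0 + (x + y : ℕ)) *
        ∑' a, eulerCoeff q a * ∏ k ∈ range (m + 1), thetaQuot q (c (k + 1)) (x + y + a) := by
  have hsplit : ∀ a, eulerCoeff q a * ∏ k ∈ range (m + 2), thetaQuot q (c k) (x + a) =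
      thetaTerm q (c 0) x * (eulerCoeff q a *
        (thetaQuot q (c 0 + x) a * ∏ k ∈ range (m + 1), thetaQuot q (c (k + 1)) (x + a))) :=
    fun a => by
      rw [prod_range_succ', thetaQuot_add hq0 (c 0)]
      ring
  have hindex : ∀ y : ℕ, (y : ℤ) + (c 0 + x) = c 0 + (x + y : ℕ) := fun y => by push_cast; ring
  have hexpand := tsum_eulerCoeff_mul_thetaQuot_mul hq0 hq1 (c 0 + x)
    (g := fun s => ∏ k ∈ range (m + 1), thetaQuot q (c (k + 1)) (x + s))
    (summable_prod_thetaQuot_add hq0 hq1 nonempty_range_add_one (fun k => c (k + 1)) x)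
  simp only [hsplit, tsum_mul_left, add_assoc, ← hindex, hexpand]

lemma tsum_eulerCoeff_mul_prod_thetaQuot_add (hq0 : q ≠ 0) (hq1 : ‖q‖ < 1) (c : ℕ → ℤ) (x m : ℕ) :
    ∑' a, eulerCoeff q a * ∏ k ∈ range (m + 1), thetaQuot q (c k) (x + a) =
      1 / qPochInf q q *
        (thetaTerm q (c 0) x * ∑' i : Fin m → ℕ, ∏ k, chainFactor q c x i k) := by
  induction m generalizing c x with
  | zero =>
    simp only [zero_add, prod_range_one, thetaQuot_add hq0, mul_left_comm (eulerCoeff q _),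
      tsum_mul_left, tsum_eulerCoeff_mul_thetaQuot hq0 hq1]
    simp [mul_comm]
  | succ m ih =>
    rw [tsum_eulerCoeff_mul_prod_thetaQuot_add_succ hq0 hq1,
      tsum_fin_succ_pi (summable_prod_chainFactor hq0 hq1 c x (m + 1)), mul_left_comm,
      ← tsum_mul_left (a := 1 / qPochInf q q)]
    congr 1
    refine tsum_congr fun y => ?_
    rw [ih (fun k => c (k + 1)), tsum_congr fun t => prod_chainFactor_cons q c x y t, tsum_mul_left]
    ring

end MultipleSeries

section Terms

variable {q : ℂ}

lemma prod_zpow_eq_zpow_sum {G ι : Type*} [CommGroupWithZero G] {a : G} (ha : a ≠ 0) (e : ι → ℤ)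
    (t : Finset ι) : ∏ k ∈ t, a ^ e k = a ^ ∑ k ∈ t, e k := by
  induction t using Finset.cons_induction with
  | empty => simp
  | cons k t hk ih => rw [prod_cons, sum_cons, ih, zpow_add₀ ha]

lemma prod_thetaTerm (hq0 : q ≠ 0) {ι : Type*} (t : Finset ι) (c : ι → ℤ) (s : ι → ℕ) :
    ∏ k ∈ t, thetaTerm q (c k) (s k) =
      (-1) ^ (∑ k ∈ t, s k) *
        q ^ ((∑ k ∈ t, (s k : ℤ) * (s k + 1)) / 2 + ∑ k ∈ t, s k * c k) := by
  simp only [thetaTerm, prod_mul_distrib, prod_pow_eq_pow_sum, prod_zpow_eq_zpow_sum hq0,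
    sum_add_distrib, ← two_mul_choose_succ_two, ← mul_sum,
    Int.mul_ediv_cancel_left _ (two_ne_zero (α := ℤ))]

lemma singleTerm_eq_eulerCoeff_mul_prod (hq0 : q ≠ 0) (m : ℕ) (c : ℕ → ℤ) (a : ℕ) :
    singleTerm q (m + 2) c a =
      eulerCoeff q a * ∏ k ∈ range (m + 1), thetaQuot q (c (k + 1)) a := by
  have hexp : ((m + 2 : ℕ) * a * (a + 1) : ℤ) / 2 - a + a * ∑ k ∈ range (m + 1), c (k + 1) =
      ((a + 1).choose 2 + a * (-1)) +
        ((∑ _k ∈ range (m + 1), (a * (a + 1) : ℤ)) / 2 + ∑ k ∈ range (m + 1), a * c (k + 1)) := by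
    have hdouble : ∀ N : ℤ, N * (a * (a + 1)) / 2 = N * (a + 1).choose 2 := fun N => by
      rw [← two_mul_choose_succ_two, mul_left_comm, Int.mul_ediv_cancel_left _ two_ne_zero]
    rw [sum_const, card_range, nsmul_eq_mul, mul_assoc, hdouble, hdouble, mul_sum]
    push_cast
    ring
  have hsign : (-1 : ℂ) ^ ((m + 2) * a) = (-1) ^ a * (-1) ^ ∑ _k ∈ range (m + 1), a := by
    rw [← pow_add, sum_const, card_range, smul_eq_mul]
    congr 1
    ring
  simp only [singleTerm, eulerCoeff, thetaQuot, prod_mul_distrib, prod_thetaTerm hq0,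
    ← Ico_add_one_right_eq_Icc, prod_Ico_eq_prod_range, sum_Ico_eq_sum_range, Nat.add_one_sub_one,
    add_comm 1, hexp, hsign, zpow_add₀ hq0 ((a + 1).choose 2 + a * (-1) : ℤ), thetaTerm.eq_1 q (-1)]
  ring

lemma multiTerm_eq_prod_chainFactor (hq0 : q ≠ 0) (m : ℕ) (c : ℕ → ℤ) (i : Fin m → ℕ) :
    multiTerm q (m + 2) c i = ∏ k, chainFactor q (fun j => c (j + 1)) 0 i k := by
  simp only [chainFactor, zero_add, prod_mul_distrib,
    Fin.prod_univ_eq_prod_range (fun k => thetaTerm q (c (k + 1 + 1)) (partSum i (k + 1))) m,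
    Fin.prod_univ_eq_prod_range (fun k => qRecip q (c (k + 1) + (partSum i (k + 1) : ℕ))) m,
    prod_thetaTerm hq0]
  have hshift : ∀ k, 2 + k = k + 1 + 1 := fun k => by omega
  have hcard : m + 2 - 1 + 1 - 2 = m := by omega
  simp only [multiTerm, ← Ico_add_one_right_eq_Icc, prod_Ico_eq_prod_range, sum_Ico_eq_sum_range,
    Nat.add_sub_cancel, hcard, hshift, add_comm 1, add_comm (1 : ℤ), mul_comm (c (_ + 1 + 1))]
  -- The two sides index their tuples by `Fin (m + 2 - 2)` and `Fin m`.
  rfl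

end Terms

theorem mainTheorem2 (q : ℂ) (hq0 : q ≠ 0) (hq1 : ‖q‖ < 1) (n : ℕ) (hn : 2 < n) (c : ℕ → ℤ) :
    Summable (fun a : ℕ => singleTerm q n c a) ∧
    Summable (fun i : Fin (n - 2) → ℕ => multiTerm q n c i) ∧
    ∑' a : ℕ, singleTerm q n c a =
      1 / qPochInf q q * ∑' i : Fin (n - 2) → ℕ, multiTerm q n c i := by
  obtain ⟨m, rfl⟩ : ∃ m, n = m + 2 := ⟨n - 2, by omega⟩
  have hsum := tsum_eulerCoeff_mul_prod_thetaQuot_add hq0 hq1 (fun k => c (k + 1)) 0 m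
  simp only [thetaTerm_zero, zero_add, one_mul] at hsum
  simp only [singleTerm_eq_eulerCoeff_mul_prod hq0, multiTerm_eq_prod_chainFactor hq0]
  exact ⟨summable_eulerCoeff_mul_prod_thetaQuot hq0 hq1 nonempty_range_add_one _,
    summable_prod_chainFactor hq0 hq1 _ 0 m, hsum⟩
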